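/- Let $n\ge 2$ and $0<\alpha<n$. Let $\mathbb{H}^n$ be hyperbolic $n$-space in the upper half-space model: $\{x\in\mathbb{R}^n : x_n>0\}$ with metric $g=x_n^{-2}\delta$ ($\delta$ the Euclidean metric), volume $dV_g=x_n^{-n}\,dx$ and distance $d_g$ given by $\cosh d_g(x,y)=1+\frac{|x-y|^2}{2x_ny_n}$. For $u\in L^1(\mathbb{H}^n)$ put $$\int_{\mathbb{H}^n}|\nabla u|_g\,dV_g:=\sup\left\{\int_{\mathbb{H}^n}u\,\mathrm{div}_gX\,dV_g : X\in C_c^1(\mathbb{H}^n,T\mathbb{H}^n),\ |X|_g\le 1\right\}\in[0,\infty],$$ and say $u\in BV(\mathbb{H}^n)$ if this is finite. For measurable $F\subset\mathbb{H}^n$ let $$P(F):=\sup\left\{\int_F\mathrm{div}_gX\,dV_g : X\in C_c^1(\mathbb{H}^n,T\mathbb{H}^n),\ |X|_g\le 1\right\},\qquad NL_\alpha(F):=\int_{\mathbb{H}^n}\int_{\mathbb{H}^n}\frac{\chi_F(x)\chi_F(y)}{d_g(x,y)^\alpha}\,dV_g(x)\,dV_g(y),$$ and say $F$ has finite perimeter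 if $\chi_F\in BV(\mathbb{H}^n)$. (a) There is a constant $c_7<\infty$ depending only on $n$ and $\alpha$ such that for every nonnegative $u\in BV(\mathbb{H}^n)\cap L^\infty(\mathbb{H}^n)$, $$\int_{\mathbb{H}^n}u^2\,dV_g\le c_7\,\|u\|_{L^\infty(\mathbb{H}^n)}^{\frac{n-\alpha}{n+1-\alpha}}\left(\int_{\mathbb{H}^n}|\nabla u|_g\,dV_g\right)^{\frac{n-\alpha}{n+1-\alpha}}\left(\int_{\mathbb{H}^n}\int_{\mathbb{H}^n}\frac{u(x)u(y)}{d_g(x,y)^\alpha}\,dV_g(x)\,dV_g(y)\right)^{\frac1{n+1-\alpha}}.$$ (b) There is a constant $c_8<\infty$ depending only on $n$ and $\alpha$ such that for every set $F\subset\mathbb{H}^n$ of finite perimeter with volume $|F|_g=m$, $$m\le c_8\,P(F)^{\frac{n-\alpha}{n+1-\alpha}}\,NL_\alpha(F)^{\frac1{n+1-\alpha}}.$$ -/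

import Mathlib

open MeasureTheory
open scoped ENNReal NNReal

noncomputable section

/-- The upper half-space model of hyperbolic `n`-space is used throughout: points are vectors of
`ℝⁿ` with positive last coordinate, and the metric is `g = δ / xₙ²`, where `δ` is the Euclidean
metric. This is the last coordinate `xₙ`. -/
def lastCoord {n : ℕ} [NeZero n] (x : EuclideanSpace ℝ (Fin n)) : ℝ :=
  x ⟨n - 1, Nat.sub_lt (NeZero.pos n) Nat.one_pos⟩

/-- The open upper half-space, the underlying set of hyperbolic `n`-space. -/
def hypSpace (n : ℕ) [NeZero n] : Set (EuclideanSpace ℝ (Fin n)) :=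
  {x | 0 < lastCoord x}

/-- The hyperbolic volume `dV_g = xₙ⁻ⁿ dx₁ ⋯ dxₙ`, a measure on `ℝⁿ` carried by the upper
half-space. Functions on hyperbolic space are represented by functions on `ℝⁿ`; the values off
the upper half-space play no role. -/
def hypVol (n : ℕ) [NeZero n] : Measure (EuclideanSpace ℝ (Fin n)) :=
  ((volume : Measure (EuclideanSpace ℝ (Fin n))).restrict (hypSpace n)).withDensity
    fun x => ENNReal.ofReal ((lastCoord x ^ n)⁻¹)

/-- The hyperbolic distance: `cosh d_g(x, y) = 1 + |x - y|² / (2 xₙ yₙ)`. -/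
def hypDist {n : ℕ} [NeZero n] (x y : EuclideanSpace ℝ (Fin n)) : ℝ :=
  Real.arcosh (1 + ‖x - y‖ ^ 2 / (2 * lastCoord x * lastCoord y))

/-- The length `|v|_g = |v| / xₙ` of a tangent vector `v` at the point `x`. -/
def hypNorm {n : ℕ} [NeZero n] (x v : EuclideanSpace ℝ (Fin n)) : ℝ :=
  ‖v‖ / lastCoord x

/-- The Riemannian divergence `div_g X = |g|^(-1/2) ∑ᵢ ∂ᵢ (|g|^(1/2) Xⁱ)`; here
`|g|^(1/2) = xₙ⁻ⁿ`. -/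
def hypDiv {n : ℕ} [NeZero n] (X : EuclideanSpace ℝ (Fin n) → EuclideanSpace ℝ (Fin n))
    (x : EuclideanSpace ℝ (Fin n)) : ℝ :=
  lastCoord x ^ n *
    ∑ i : Fin n, fderiv ℝ (fun y => (lastCoord y ^ n)⁻¹ * X y i) x (EuclideanSpace.single i 1)

/-- The vector fields `X ∈ C_c¹(ℍⁿ, Tℍⁿ)` with `|X|_g ≤ 1`, extended by zero to `ℝⁿ`. -/
def hypTestFields (n : ℕ) [NeZero n] :
    Set (EuclideanSpace ℝ (Fin n) → EuclideanSpace ℝ (Fin n)) :=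
  {X | ContDiff ℝ 1 X ∧ HasCompactSupport X ∧ tsupport X ⊆ hypSpace n ∧
    ∀ x ∈ hypSpace n, hypNorm x (X x) ≤ 1}

/-- The total variation `∫ |∇u|_g dV_g`, the supremum of `∫ u div_g X dV_g` over the test fields.
As the zero field is a test field, truncating negative values to `0` does not change it. -/
def hypVariation {n : ℕ} [NeZero n] (u : EuclideanSpace ℝ (Fin n) → ℝ) : ℝ≥0∞ :=
  ⨆ X ∈ hypTestFields n, ENNReal.ofReal (∫ x, u x * hypDiv X x ∂(hypVol n))

/-- `u ∈ BV(ℍⁿ)`. -/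
def HypBV {n : ℕ} [NeZero n] (u : EuclideanSpace ℝ (Fin n) → ℝ) : Prop :=
  Integrable u (hypVol n) ∧ hypVariation u < ∞

/-- The De Giorgi perimeter `P(F)`, the supremum of `∫_F div_g X dV_g` over the test fields. -/
def hypPerimeter {n : ℕ} [NeZero n] (F : Set (EuclideanSpace ℝ (Fin n))) : ℝ≥0∞ :=
  ⨆ X ∈ hypTestFields n, ENNReal.ofReal (∫ x in F, hypDiv X x ∂(hypVol n))

/-- `F` has finite perimeter: its characteristic function is in `BV(ℍⁿ)`. -/
def HypFinitePerimeter {n : ℕ} [NeZero n] (F : Set (EuclideanSpace ℝ (Fin n))) : Prop :=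
  HypBV (F.indicator fun _ => (1 : ℝ))

/-- The energy `∬ u(x) u(y) d_g(x, y)^(-α) dV_g(x) dV_g(y)` of a nonnegative function `u`
(the diagonal is a null set, so the value of the integrand on it is irrelevant). -/
def hypEnergy {n : ℕ} [NeZero n] (α : ℝ) (u : EuclideanSpace ℝ (Fin n) → ℝ) : ℝ≥0∞ :=
  ∫⁻ y, ∫⁻ x, ENNReal.ofReal (u x * u y / hypDist x y ^ α) ∂(hypVol n) ∂(hypVol n)

/-- The nonlocal term `NL_α(F)`. -/
def hypNL {n : ℕ} [NeZero n] (α : ℝ) (F : Set (EuclideanSpace ℝ (Fin n))) : ℝ≥0∞ :=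
  hypEnergy α (F.indicator fun _ => (1 : ℝ))

end

/-!
The proof compares `u` with its translates. The half-space is a group acting on itself by
isometries from the left, and the right translations are the linear maps `x ↦ x + xₙ w`. They move
every point by the same distance, comparable to `‖w‖` for small `w`, and the fields `x ↦ xₙ w`
generating them have constant length and constant divergence.

Transporting a test function `ψ` along the flow `x ↦ x + t xₙ w` therefore changes its pairing with
`u` at a rate given by the pairing of `u` with a divergence, which the total variation controls
(`abs_integral_transported_sub_le`). After smooth approximation `ψ` can be replaced by `u`, so
`∫ u²` is at most a multiple of `∫ u(x) u(x + xₙ w) dV + ‖u‖_∞ ‖w‖ ∫ |∇u|` (`integral_sq_le_add`).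
Averaging over `‖w‖ < r` with `r ≤ 1 / 2`, the first term is at most a multiple of `r ^ (α - n)`
times the energy, because the points `x + xₙ w` sweep out a ball on which the kernel is at least
`(2 r) ^ (-α)` (`lintegral_ball_lintegral_correlation_le`). Hence
`∫ u² ≤ C (r ‖u‖_∞ ∫ |∇u| + r ^ (α - n) E)` for all `r ≤ 1 / 2`.

The radius that balances the two terms gives the inequality whenever it is at most `1 / 2`. If it is
not, then `‖u‖_∞ ∫ |∇u|` is bounded by a multiple of `E`, and the linear isoperimetric inequality
`∫ u ≤ ∫ |∇u|` (`integral_le_hypVariation`), which comes from the vertical unit field, gives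
`∫ u² ≤ ‖u‖_∞ ∫ |∇u|` and concludes. The statement on sets is the case of a characteristic function.
-/

open Filter Topology

section

variable {n : ℕ} [NeZero n]

/-! ### The half-space and its volume -/

/-- The last coordinate as a continuous linear form. -/
noncomputable def lastCoordL (n : ℕ) [NeZero n] : EuclideanSpace ℝ (Fin n) →L[ℝ] ℝ :=
  EuclideanSpace.proj ⟨n - 1, Nat.sub_lt (NeZero.pos n) Nat.one_pos⟩

theorem lastCoordL_apply (x : EuclideanSpace ℝ (Fin n)) : lastCoordL n x = lastCoord x := rfl

theorem lastCoord_add_smul (x w : EuclideanSpace ℝ (Fin n)) (a : ℝ) :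
    lastCoord (x + a • w) = lastCoord x + a * lastCoord w := rfl

theorem continuous_lastCoord : Continuous (lastCoord : EuclideanSpace ℝ (Fin n) → ℝ) :=
  (lastCoordL n).continuous

theorem abs_lastCoord_le (w : EuclideanSpace ℝ (Fin n)) : |lastCoord w| ≤ ‖w‖ :=
  PiLp.norm_apply_le w _

theorem isOpen_hypSpace : IsOpen (hypSpace n) :=
  isOpen_lt continuous_const continuous_lastCoord

theorem measurableSet_hypSpace : MeasurableSet (hypSpace n) := isOpen_hypSpace.measurableSet

theorem measurable_hypDensity :
    Measurable fun x : EuclideanSpace ℝ (Fin n) => ENNReal.ofReal ((lastCoord x ^ n)⁻¹) :=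
  ((continuous_lastCoord.measurable.pow_const n).inv).ennreal_ofReal

theorem hypVol_absolutelyContinuous_restrict :
    hypVol n ≪ (volume : Measure (EuclideanSpace ℝ (Fin n))).restrict (hypSpace n) :=
  withDensity_absolutelyContinuous _ _

theorem hypVol_absolutelyContinuous :
    hypVol n ≪ (volume : Measure (EuclideanSpace ℝ (Fin n))) :=
  hypVol_absolutelyContinuous_restrict.trans Measure.restrict_le_self.absolutelyContinuous

theorem ae_mem_hypSpace : ∀ᵐ x ∂(hypVol n), x ∈ hypSpace n :=
  hypVol_absolutelyContinuous_restrict.ae_le (ae_restrict_mem measurableSet_hypSpace)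

instance : SFinite (hypVol n) := by unfold hypVol; infer_instance

/-! ### Divergence along left-invariant fields -/

/-- The divergence of `f` times the left-invariant field `x ↦ xₙ w`, whose own divergence is the
constant `-(n - 1) wₙ`. -/
theorem hypDiv_mul_lastCoord_smul {f : EuclideanSpace ℝ (Fin n) → ℝ}
    {x w : EuclideanSpace ℝ (Fin n)} (hf : DifferentiableAt ℝ f x) (hx : x ∈ hypSpace n) :
    hypDiv (fun y => (f y * lastCoord y) • w) x =
      lastCoord x * fderiv ℝ f x w - (n - 1) * lastCoord w * f x := by
  have hx' : 0 < lastCoord x := hx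
  have hl : HasFDerivAt (lastCoord : EuclideanSpace ℝ (Fin n) → ℝ) (lastCoordL n) x :=
    (lastCoordL n).hasFDerivAt
  have hp := ((hasDerivAt_pow n (lastCoord x)).fun_inv
    (pow_ne_zero n hx'.ne')).comp_hasFDerivAt x hl
  have hq := HasFDerivAt.fun_mul hp (hf.hasFDerivAt.fun_mul hl)
  set p : EuclideanSpace ℝ (Fin n) →L[ℝ] ℝ := _ with hpdef
  change HasFDerivAt (fun y => (lastCoord y ^ n)⁻¹ * (f y * lastCoord y)) p x at hq
  have hi : ∀ i : Fin n, fderiv ℝ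
      (fun y => (lastCoord y ^ n)⁻¹ * (((f y * lastCoord y) • w : EuclideanSpace ℝ (Fin n)) i)) x
        (EuclideanSpace.single i 1) = p (w i • EuclideanSpace.single i 1) := by
    intro i
    have h := hq.mul_const (w i)
    have e : (fun y => (lastCoord y ^ n)⁻¹ *
        (((f y * lastCoord y) • w : EuclideanSpace ℝ (Fin n)) i)) =
        fun y => (lastCoord y ^ n)⁻¹ * (f y * lastCoord y) * w i := by
      funext y
      simp [mul_assoc]
    rw [e, h.fderiv]
    simp
  unfold hypDiv
  rw [Finset.sum_congr rfl fun i _ => hi i, ← map_sum]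
  have hw : ∑ i : Fin n, w i • (EuclideanSpace.single i 1 : EuclideanSpace ℝ (Fin n)) = w := by
    ext j
    simp [Finset.sum_apply, Pi.single_apply]
  rw [hw, hpdef]
  simp only [Function.comp, add_apply, smul_apply,
    smul_eq_mul, lastCoordL_apply]
  obtain ⟨m, rfl⟩ : ∃ m, n = m + 1 := ⟨n - 1, (Nat.sub_add_cancel (NeZero.pos n)).symm⟩
  simp only [Nat.add_sub_cancel]
  field_simp
  push_cast
  ring

/-- Testing the variation of `u` against a multiple `f` of a left-invariant field. -/
theorem abs_integral_mul_divergence_le {u f : EuclideanSpace ℝ (Fin n) → ℝ}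
    {w : EuclideanSpace ℝ (Fin n)} {K : ℝ} (hu : hypVariation u < ∞) (hK : 0 < K)
    (hf : ContDiff ℝ 1 f) (hfc : HasCompactSupport f) (hfs : tsupport f ⊆ hypSpace n)
    (hfK : ∀ x, |f x| * ‖w‖ ≤ K) :
    |∫ x, u x * (lastCoord x * fderiv ℝ f x w - (n - 1) * lastCoord w * f x) ∂(hypVol n)| ≤
      K * (hypVariation u).toReal := by
  -- `c = K⁻¹` and `c = -K⁻¹` give the two signs
  have key : ∀ c : ℝ, |c| = K⁻¹ →
      c * ∫ x, u x * (lastCoord x * fderiv ℝ f x w - (n - 1) * lastCoord w * f x) ∂(hypVol n) ≤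
        (hypVariation u).toReal := by
    intro c hc
    have hcf : ContDiff ℝ 1 fun y => c * f y := contDiff_const.mul hf
    have hsupp : tsupport (fun y => ((c * f y) * lastCoord y) • w) ⊆ tsupport f := by
      apply closure_mono
      intro y hy
      contrapose! hy
      simp only [Function.mem_support, not_not] at hy ⊢
      simp [hy]
    have hX : (fun y => ((c * f y) * lastCoord y) • w) ∈ hypTestFields n := by
      refine ⟨?_, ?_, hsupp.trans hfs, ?_⟩
      · exact (hcf.mul (lastCoordL n).contDiff).smul contDiff_const
      · exact IsCompact.of_isClosed_subset hfc (isClosed_tsupport _) hsupp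
      · intro x hx
        have hx' : 0 < lastCoord x := hx
        unfold hypNorm
        rw [norm_smul, Real.norm_eq_abs, abs_mul, abs_mul, abs_of_pos hx', hc]
        rw [div_le_one hx']
        calc K⁻¹ * |f x| * lastCoord x * ‖w‖ = K⁻¹ * (|f x| * ‖w‖) * lastCoord x := by ring
          _ ≤ K⁻¹ * K * lastCoord x := by gcongr; exact hfK x
          _ = lastCoord x := by field_simp
    have h1 : ENNReal.ofReal (∫ x, u x * hypDiv (fun y => ((c * f y) * lastCoord y) • w) x
        ∂(hypVol n)) ≤ hypVariation u :=
      le_iSup₂ (f := fun X (_ : X ∈ hypTestFields n) =>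
        ENNReal.ofReal (∫ x, u x * hypDiv X x ∂(hypVol n))) _ hX
    rw [ENNReal.ofReal_le_iff_le_toReal hu.ne] at h1
    refine le_trans (le_of_eq ?_) h1
    rw [← integral_const_mul]
    apply integral_congr_ae
    filter_upwards [ae_mem_hypSpace] with x hx
    have hfx : DifferentiableAt ℝ f x := hf.differentiable one_ne_zero x
    rw [hypDiv_mul_lastCoord_smul (hcf.differentiable one_ne_zero x) hx, fderiv_const_mul hfx]
    simp only [smul_apply, smul_eq_mul]
    ring
  have h1 := key K⁻¹ (abs_of_pos (inv_pos.2 hK))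
  have h2 := key (-K⁻¹) (by rw [abs_neg, abs_of_pos (inv_pos.2 hK)])
  rw [abs_le]
  rw [inv_mul_le_iff₀ hK] at h1
  rw [neg_mul, ← mul_neg, inv_mul_le_iff₀ hK] at h2
  constructor <;> linarith

/-! ### Optimization in the radius -/

/-- The balancing radius `(E / B) ^ (1 / (β + 1))` is used if it is at most `1 / 2`; otherwise `B`
itself is dominated by the right side, and `A ≤ C * B` suffices. -/
theorem le_mul_rpow_mul_rpow_of_forall_radius {A B E C β : ℝ} (hB : 0 ≤ B) (hE : 0 ≤ E)
    (hC : 0 ≤ C) (hβ : 0 < β) (hAB : A ≤ C * B)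
    (h : ∀ r : ℝ, 0 < r → r ≤ 1 / 2 → A ≤ C * (r * B + r ^ (-β) * E)) :
    A ≤ 2 * C * (B ^ (β / (β + 1)) * E ^ (1 / (β + 1))) := by
  have hs : β / (β + 1) + 1 / (β + 1) = 1 := by field_simp
  have hp : 0 < β / (β + 1) := by positivity
  have hq : 0 < 1 / (β + 1) := by positivity
  rcases hB.eq_or_lt with rfl | hB
  · rw [Real.zero_rpow hp.ne']; linarith
  have hBB : B = B ^ (β / (β + 1)) * B ^ (1 / (β + 1)) := by
    rw [← Real.rpow_add hB, hs, Real.rpow_one]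
  rcases hE.eq_or_lt with rfl | hE
  · -- without energy the radius can be sent to `0`
    rw [Real.zero_rpow hq.ne', mul_zero, mul_zero]
    have ht : Tendsto (fun r : ℝ => C * (r * B + r ^ (-β) * 0)) (𝓝[>] 0) (𝓝 0) := by
      have : Tendsto (fun r : ℝ => C * (r * B + r ^ (-β) * 0)) (𝓝 0) (𝓝 0) := by
        have : Continuous fun r : ℝ => C * (r * B + r ^ (-β) * 0) := by
          simp only [mul_zero, add_zero]; fun_prop
        simpa using this.tendsto 0
      exact this.mono_left nhdsWithin_le_nhds
    refine ge_of_tendsto ht ?_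
    filter_upwards [Ioc_mem_nhdsGT (show (0 : ℝ) < 1 / 2 by norm_num)] with r hr
    exact h r hr.1 hr.2
  by_cases hEB : (E / B) ^ (1 / (β + 1)) ≤ 1 / 2
  · -- the radius that balances the two terms is admissible
    set r := (E / B) ^ (1 / (β + 1)) with hr
    have hr0 : 0 < r := by positivity
    have e1 : r * B = B ^ (β / (β + 1)) * E ^ (1 / (β + 1)) := by
      rw [hr, Real.div_rpow hE.le hB.le]
      nth_rewrite 2 [hBB]
      field_simp
    have e2 : r ^ (-β) * E = B ^ (β / (β + 1)) * E ^ (1 / (β + 1)) := by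
      have hEE : E = E ^ (β / (β + 1)) * E ^ (1 / (β + 1)) := by
        rw [← Real.rpow_add hE, hs, Real.rpow_one]
      rw [hr, ← Real.rpow_mul (by positivity), show 1 / (β + 1) * -β = -(β / (β + 1)) by ring,
        Real.rpow_neg (by positivity), Real.div_rpow hE.le hB.le]
      nth_rewrite 2 [hEE]
      have := Real.rpow_pos_of_pos hE (β / (β + 1))
      field_simp
    have := h r hr0 hEB
    rw [e1, e2] at this
    linarith
  · push Not at hEB
    rw [Real.div_rpow hE.le hB.le, lt_div_iff₀ (by positivity)] at hEB
    refine hAB.trans ?_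
    rw [mul_comm 2 C, mul_assoc]
    gcongr
    nth_rewrite 1 [hBB]
    have := mul_le_mul_of_nonneg_left hEB.le (Real.rpow_nonneg hB.le (β / (β + 1)))
    linarith

/-! ### Cutoff functions and the linear isoperimetric inequality -/

theorem exists_abs_deriv_smoothTransition_le :
    ∃ L : ℝ, 0 ≤ L ∧ ∀ t, |deriv Real.smoothTransition t| ≤ L ∧
      (t ∉ Set.Icc (0 : ℝ) 1 → deriv Real.smoothTransition t = 0) := by
  have hz : ∀ t, t ∉ Set.Icc (0 : ℝ) 1 → deriv Real.smoothTransition t = 0 := by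
    intro t ht
    rcases lt_or_ge t 0 with h | h
    · have : Real.smoothTransition =ᶠ[𝓝 t] fun _ => 0 := by
        filter_upwards [Iio_mem_nhds h] with s hs
        exact Real.smoothTransition.zero_of_nonpos (le_of_lt hs)
      rw [this.deriv_eq, deriv_const]
    · have h1 : 1 < t := by
        by_contra hc
        exact ht ⟨h, not_lt.1 hc⟩
      have : Real.smoothTransition =ᶠ[𝓝 t] fun _ => 1 := by
        filter_upwards [Ioi_mem_nhds h1] with s hs
        exact Real.smoothTransition.one_of_one_le (le_of_lt hs)
      rw [this.deriv_eq, deriv_const]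
  have hc : Continuous (deriv Real.smoothTransition) :=
    (Real.smoothTransition.contDiff (n := 1)).continuous_deriv le_rfl
  obtain ⟨L, hL⟩ := isCompact_Icc.exists_bound_of_continuousOn (s := Set.Icc (0 : ℝ) 1)
    hc.continuousOn
  refine ⟨L, (norm_nonneg _).trans (hL 0 (by simp)), fun t => ⟨?_, hz t⟩⟩
  by_cases ht : t ∈ Set.Icc (0 : ℝ) 1
  · exact hL t ht
  · rw [hz t ht, abs_zero]
    exact (norm_nonneg _).trans (hL 0 (by simp))

/-- A smooth cutoff, equal to `1` where `xₙ ≥ 2 / (k + 1)` and `|x| ≤ k + 1`, and to `0` where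
`xₙ ≤ 1 / (k + 1)` or `|x| ≥ √2 (k + 1)`. Its derivative is bounded at hyperbolic scale,
uniformly in `k`. -/
noncomputable def hypCutoff (k : ℕ) (x : EuclideanSpace ℝ (Fin n)) : ℝ :=
  Real.smoothTransition ((k + 1) * lastCoord x - 1) *
    Real.smoothTransition (2 - ‖x‖ ^ 2 / (k + 1) ^ 2)

theorem hypCutoff_nonneg (k : ℕ) (x : EuclideanSpace ℝ (Fin n)) : 0 ≤ hypCutoff k x :=
  mul_nonneg (Real.smoothTransition.nonneg _) (Real.smoothTransition.nonneg _)

theorem hypCutoff_le_one (k : ℕ) (x : EuclideanSpace ℝ (Fin n)) : hypCutoff k x ≤ 1 :=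
  mul_le_one₀ (Real.smoothTransition.le_one _) (Real.smoothTransition.nonneg _)
    (Real.smoothTransition.le_one _)

theorem contDiff_hypCutoff (k : ℕ) :
    ContDiff ℝ 1 (hypCutoff k : EuclideanSpace ℝ (Fin n) → ℝ) := by
  unfold hypCutoff
  refine (Real.smoothTransition.contDiff (n := 1).comp ?_).mul
    (Real.smoothTransition.contDiff (n := 1).comp ?_)
  · exact (contDiff_const.mul (lastCoordL n).contDiff).sub contDiff_const
  · exact contDiff_const.sub ((contDiff_norm_sq ℝ).div_const _)

theorem tsupport_hypCutoff_subset (k : ℕ) :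
    tsupport (hypCutoff k : EuclideanSpace ℝ (Fin n) → ℝ) ⊆
      {x | 1 ≤ (k + 1) * lastCoord x} ∩ Metric.closedBall 0 (2 * (k + 1)) := by
  refine closure_minimal ?_ (IsClosed.inter
    (isClosed_le continuous_const (continuous_const.mul continuous_lastCoord))
    Metric.isClosed_closedBall)
  intro x hx
  have h := mul_ne_zero_iff.1 (show Real.smoothTransition ((k + 1) * lastCoord x - 1) *
    Real.smoothTransition (2 - ‖x‖ ^ 2 / (k + 1) ^ 2) ≠ 0 from hx)
  have hk : (0 : ℝ) < k + 1 := by positivity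
  constructor
  · by_contra hc
    simp only [Set.mem_ofPred_eq, not_le] at hc
    exact h.1 (Real.smoothTransition.zero_of_nonpos (by linarith))
  · rw [mem_closedBall_zero_iff]
    by_contra hc
    push Not at hc
    apply h.2 (Real.smoothTransition.zero_of_nonpos _)
    rw [sub_nonpos, le_div_iff₀ (by positivity)]
    nlinarith

theorem tsupport_hypCutoff_subset_hypSpace (k : ℕ) :
    tsupport (hypCutoff k : EuclideanSpace ℝ (Fin n) → ℝ) ⊆ hypSpace n := by
  intro x hx
  have h : 1 ≤ ((k : ℝ) + 1) * lastCoord x := (tsupport_hypCutoff_subset k hx).1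
  exact pos_of_mul_pos_right (lt_of_lt_of_le one_pos h) (by positivity)

theorem hasCompactSupport_hypCutoff (k : ℕ) :
    HasCompactSupport (hypCutoff k : EuclideanSpace ℝ (Fin n) → ℝ) :=
  IsCompact.of_isClosed_subset (isCompact_closedBall 0 (2 * ((k : ℝ) + 1)))
    (isClosed_tsupport _) ((tsupport_hypCutoff_subset k).trans Set.inter_subset_right)

theorem eventually_hypCutoff_eventuallyEq_one {x : EuclideanSpace ℝ (Fin n)}
    (hx : x ∈ hypSpace n) : ∀ᶠ k : ℕ in atTop, hypCutoff k =ᶠ[𝓝 x] fun _ => 1 := by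
  have hx' : 0 < lastCoord x := hx
  have h1 : ∀ᶠ k : ℕ in atTop, 2 / lastCoord x < (k : ℝ) :=
    tendsto_natCast_atTop_atTop.eventually_gt_atTop _
  have h2 : ∀ᶠ k : ℕ in atTop, ‖x‖ < (k : ℝ) :=
    tendsto_natCast_atTop_atTop.eventually_gt_atTop _
  filter_upwards [h1, h2] with k hk1 hk2
  rw [div_lt_iff₀ hx'] at hk1
  have o1 : ∀ᶠ y in 𝓝 x, 2 < (k + 1) * lastCoord y :=
    (isOpen_lt continuous_const (continuous_const.mul continuous_lastCoord)).mem_nhds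
      (show 2 < ((k : ℝ) + 1) * lastCoord x by nlinarith)
  have o2 : ∀ᶠ y in 𝓝 x, ‖y‖ < k + 1 :=
    (isOpen_lt continuous_norm continuous_const).mem_nhds
      (show ‖x‖ < (k : ℝ) + 1 by linarith)
  filter_upwards [o1, o2] with y h1 h2
  unfold hypCutoff
  rw [Real.smoothTransition.one_of_one_le (by linarith), Real.smoothTransition.one_of_one_le,
    mul_one]
  have : ‖y‖ ^ 2 / ((k : ℝ) + 1) ^ 2 ≤ 1 := by
    rw [div_le_one (by positivity)]
    gcongr
  linarith

theorem exists_abs_lastCoord_mul_fderiv_hypCutoff_le (n : ℕ) [NeZero n] :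
    ∃ C : ℝ, ∀ (k : ℕ) (x w : EuclideanSpace ℝ (Fin n)), x ∈ hypSpace n → ‖w‖ ≤ 1 →
      |lastCoord x * fderiv ℝ (hypCutoff k) x w| ≤ C := by
  obtain ⟨L, hL0, hL⟩ := exists_abs_deriv_smoothTransition_le
  refine ⟨2 * L + 4 * L, fun k x w hx hw => ?_⟩
  have hx' : 0 < lastCoord x := hx
  have hk : (0 : ℝ) < k + 1 := by positivity
  set a := ((k : ℝ) + 1) * lastCoord x - 1 with ha
  set b := 2 - ‖x‖ ^ 2 / ((k : ℝ) + 1) ^ 2 with hb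
  have hη : ∀ t, HasDerivAt Real.smoothTransition (deriv Real.smoothTransition t) t := fun t =>
    ((Real.smoothTransition.contDiff (n := 1)).differentiable one_ne_zero t).hasDerivAt
  have h1 : HasFDerivAt (fun y : EuclideanSpace ℝ (Fin n) => ((k : ℝ) + 1) * lastCoord y - 1)
      (((k : ℝ) + 1) • lastCoordL n) x :=
    ((lastCoordL n).hasFDerivAt.const_mul _).sub_const _
  have h2 : HasFDerivAt (fun y : EuclideanSpace ℝ (Fin n) => 2 - ‖y‖ ^ 2 / ((k : ℝ) + 1) ^ 2)
      (-((((k : ℝ) + 1) ^ 2)⁻¹ • (2 • innerSL ℝ x))) x := by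
    have := ((hasStrictFDerivAt_norm_sq x).hasFDerivAt.const_mul
      ((((k : ℝ) + 1) ^ 2)⁻¹)).const_sub 2
    refine this.congr_of_eventuallyEq (Eventually.of_forall fun y => ?_)
    simp only [div_eq_inv_mul]
  have h := ((hη a).comp_hasFDerivAt x h1).mul ((hη b).comp_hasFDerivAt x h2)
  have e : fderiv ℝ (hypCutoff k) x w = Real.smoothTransition a * (deriv Real.smoothTransition b *
      (-((((k : ℝ) + 1) ^ 2)⁻¹ * (2 * inner ℝ x w)))) + Real.smoothTransition b *
      (deriv Real.smoothTransition a * (((k : ℝ) + 1) * lastCoord w)) := by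
    have h' : HasFDerivAt (hypCutoff k) _ x := h
    rw [h'.fderiv]
    simp [lastCoordL_apply, Function.comp, ha, hb]
  have hwn : |lastCoord w| ≤ 1 := (abs_lastCoord_le w).trans hw
  have hin : |inner ℝ x w| ≤ ‖x‖ :=
    (abs_real_inner_le_norm x w).trans (mul_le_of_le_one_right (norm_nonneg x) hw)
  have s01 : ∀ t, |Real.smoothTransition t| ≤ 1 := fun t => by
    rw [abs_of_nonneg (Real.smoothTransition.nonneg t)]
    exact Real.smoothTransition.le_one t
  rw [e, mul_add]
  refine (abs_add_le _ _).trans ?_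
  rw [add_comm (2 * L)]
  apply add_le_add
  · by_cases hbI : b ∈ Set.Icc (0 : ℝ) 1
    · have hn : ‖x‖ ^ 2 ≤ 2 * ((k : ℝ) + 1) ^ 2 := by
        have := hbI.1
        rw [hb, sub_nonneg, div_le_iff₀ (by positivity)] at this
        exact this
      have hxn : lastCoord x ≤ ‖x‖ := (le_abs_self _).trans (abs_lastCoord_le x)
      rw [abs_mul, abs_mul, abs_mul, abs_neg, abs_mul, abs_mul, abs_of_pos hx',
        abs_of_pos (show 0 < ((((k : ℝ) + 1) ^ 2)⁻¹) by positivity), abs_two]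
      calc lastCoord x * (|Real.smoothTransition a| * (|deriv Real.smoothTransition b| *
            ((((k : ℝ) + 1) ^ 2)⁻¹ * (2 * |inner ℝ x w|))))
          ≤ ‖x‖ * (1 * (L * ((((k : ℝ) + 1) ^ 2)⁻¹ * (2 * ‖x‖)))) := by
            gcongr
            · exact s01 a
            · exact (hL b).1
        _ = 2 * L * ((((k : ℝ) + 1) ^ 2)⁻¹ * ‖x‖ ^ 2) := by ring
        _ ≤ 2 * L * ((((k : ℝ) + 1) ^ 2)⁻¹ * (2 * ((k : ℝ) + 1) ^ 2)) := by gcongr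
        _ = 4 * L := by field_simp; ring
    · rw [(hL b).2 hbI]
      simpa using hL0
  · by_cases haI : a ∈ Set.Icc (0 : ℝ) 1
    · have hka : ((k : ℝ) + 1) * lastCoord x ≤ 2 := by
        have := haI.2
        rw [ha] at this
        linarith
      rw [abs_mul, abs_mul, abs_mul, abs_mul, abs_of_pos hx', abs_of_pos hk]
      calc lastCoord x * (|Real.smoothTransition b| * (|deriv Real.smoothTransition a| *
            (((k : ℝ) + 1) * |lastCoord w|)))
          ≤ lastCoord x * (1 * (L * (((k : ℝ) + 1) * 1))) := by
            gcongr
            · exact s01 b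
            · exact (hL a).1
        _ = L * (((k : ℝ) + 1) * lastCoord x) := by ring
        _ ≤ L * 2 := by gcongr
        _ = 2 * L := by ring
    · rw [(hL a).2 haI]
      simpa using hL0

/-- The linear isoperimetric inequality: the vertical unit field `-xₙ eₙ` has constant divergence
`n - 1 ≥ 1`, and the cutoffs make it admissible. -/
theorem integral_le_hypVariation (hn : 2 ≤ n) {u : EuclideanSpace ℝ (Fin n) → ℝ}
    (hu : Integrable u (hypVol n)) (hu0 : ∀ x, 0 ≤ u x) (hv : hypVariation u < ∞) :
    ∫ x, u x ∂(hypVol n) ≤ (hypVariation u).toReal := by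
  obtain ⟨C, hC⟩ := exists_abs_lastCoord_mul_fderiv_hypCutoff_le n
  set e : EuclideanSpace ℝ (Fin n) :=
    -EuclideanSpace.single ⟨n - 1, Nat.sub_lt (NeZero.pos n) Nat.one_pos⟩ 1 with he
  have hen : ‖e‖ = 1 := by simp [he]
  have hel : lastCoord e = -1 := by simp [he, lastCoord]
  have hn1 : (1 : ℝ) ≤ n - 1 := by
    have : (2 : ℝ) ≤ n := by exact_mod_cast hn
    linarith
  have hk : ∀ k : ℕ, ∫ x, u x * (lastCoord x * fderiv ℝ (hypCutoff k) x e -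
      (n - 1) * lastCoord e * hypCutoff k x) ∂(hypVol n) ≤ (hypVariation u).toReal := by
    intro k
    have := abs_integral_mul_divergence_le (w := e) hv one_pos (contDiff_hypCutoff k)
      (hasCompactSupport_hypCutoff k) (tsupport_hypCutoff_subset_hypSpace k) (fun x => by
        rw [hen, mul_one, abs_of_nonneg (hypCutoff_nonneg k x)]
        exact hypCutoff_le_one k x)
    rw [one_mul] at this
    exact (le_abs_self _).trans this
  have hlim : Tendsto (fun k : ℕ => ∫ x, u x * (lastCoord x * fderiv ℝ (hypCutoff k) x e -
      (n - 1) * lastCoord e * hypCutoff k x) ∂(hypVol n)) atTop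
      (𝓝 (∫ x, u x * (n - 1) ∂(hypVol n))) := by
    refine tendsto_integral_of_dominated_convergence (fun x => ‖u x‖ * (C + (n - 1))) ?_
      (hu.norm.mul_const _) ?_ ?_
    · intro k
      have hc : Continuous fun x : EuclideanSpace ℝ (Fin n) =>
          lastCoord x * fderiv ℝ (hypCutoff k) x e - (n - 1) * lastCoord e * hypCutoff k x :=
        (continuous_lastCoord.mul
          (((contDiff_hypCutoff k).continuous_fderiv one_ne_zero).clm_apply
            continuous_const)).sub (continuous_const.mul (contDiff_hypCutoff k).continuous)
      exact hu.aestronglyMeasurable.mul hc.aestronglyMeasurable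
    · intro k
      filter_upwards [ae_mem_hypSpace] with x hx
      rw [norm_mul]
      gcongr
      refine (norm_sub_le _ _).trans (add_le_add (hC k x e hx hen.le) ?_)
      rw [hel, Real.norm_eq_abs, abs_mul, abs_of_nonneg (hypCutoff_nonneg k x)]
      have : |((n : ℝ) - 1) * -1| = n - 1 := by
        rw [mul_neg, mul_one, abs_neg, abs_of_nonneg (by linarith)]
      rw [this]
      exact mul_le_of_le_one_right (by linarith) (hypCutoff_le_one k x)
    · filter_upwards [ae_mem_hypSpace] with x hx
      refine tendsto_const_nhds.congr' ?_
      filter_upwards [eventually_hypCutoff_eventuallyEq_one hx] with k hk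
      rw [hk.fderiv_eq, hk.self_of_nhds, hel]
      simp
  have h := le_of_tendsto hlim (Eventually.of_forall hk)
  rw [integral_mul_const] at h
  have h0 : 0 ≤ ∫ x, u x ∂(hypVol n) := integral_nonneg hu0
  nlinarith

/-! ### Right translations -/

/-- The linear map `x ↦ x + xₙ w`. For `wₙ > -1` it is the right translation by the point
`eₙ + w` in the group structure on the half-space for which left translations are isometries; it
moves every point by the same hyperbolic distance. -/
noncomputable def rightTranslate (w : EuclideanSpace ℝ (Fin n)) :
    EuclideanSpace ℝ (Fin n) →L[ℝ] EuclideanSpace ℝ (Fin n) :=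
  ContinuousLinearMap.id ℝ _ + (lastCoordL n).smulRight w

theorem rightTranslate_apply (w x : EuclideanSpace ℝ (Fin n)) :
    rightTranslate w x = x + lastCoord x • w := rfl

theorem lastCoord_rightTranslate (w x : EuclideanSpace ℝ (Fin n)) :
    lastCoord (rightTranslate w x) = lastCoord x * (1 + lastCoord w) := by
  rw [rightTranslate_apply, lastCoord_add_smul]; ring

theorem ker_rightTranslate {w : EuclideanSpace ℝ (Fin n)} (hw : 0 < 1 + lastCoord w) :
    LinearMap.ker (rightTranslate w).toLinearMap = ⊥ := by
  rw [LinearMap.ker_eq_bot']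
  intro x hx
  have hx' : rightTranslate w x = 0 := hx
  have h := lastCoord_rightTranslate w x
  rw [hx'] at h
  have h0 : lastCoord x = 0 := by
    have : lastCoord (0 : EuclideanSpace ℝ (Fin n)) = 0 := rfl
    rw [this] at h
    exact (mul_eq_zero.1 h.symm).resolve_right hw.ne'
  rw [rightTranslate_apply, h0, zero_smul, add_zero] at hx'
  exact hx'

theorem rightTranslate_mem_hypSpace {w : EuclideanSpace ℝ (Fin n)} (hw : 0 < 1 + lastCoord w)
    {x : EuclideanSpace ℝ (Fin n)} : rightTranslate w x ∈ hypSpace n ↔ x ∈ hypSpace n := by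
  change 0 < lastCoord _ ↔ 0 < lastCoord _
  rw [lastCoord_rightTranslate]
  exact mul_pos_iff_of_pos_right hw

theorem quasiMeasurePreserving_rightTranslate {w : EuclideanSpace ℝ (Fin n)}
    (hw : 0 < 1 + lastCoord w) :
    Measure.QuasiMeasurePreserving (rightTranslate w) (volume : Measure (EuclideanSpace ℝ (Fin n)))
      volume := by
  apply Measure.ContinuousLinearMap.quasiMeasurePreserving
  intro h
  exact (LinearMap.bot_lt_ker_of_det_eq_zero h).ne' (ker_rightTranslate hw)

theorem hasCompactSupport_comp_rightTranslate {w : EuclideanSpace ℝ (Fin n)}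
    (hw : 0 < 1 + lastCoord w) {ψ : EuclideanSpace ℝ (Fin n) → ℝ} (hψ : HasCompactSupport ψ) :
    HasCompactSupport fun x => ψ (rightTranslate w x) :=
  hψ.comp_isClosedEmbedding (LinearMap.isClosedEmbedding_of_injective (ker_rightTranslate hw))

theorem tsupport_comp_rightTranslate_subset {w : EuclideanSpace ℝ (Fin n)}
    (hw : 0 < 1 + lastCoord w) {ψ : EuclideanSpace ℝ (Fin n) → ℝ} (hψ : tsupport ψ ⊆ hypSpace n) :
    tsupport (fun x => ψ (rightTranslate w x)) ⊆ hypSpace n := fun _ hx =>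
  (rightTranslate_mem_hypSpace hw).1
    (hψ (tsupport_comp_subset_preimage ψ (rightTranslate w).continuous hx))

/-! ### Variation of a function along a right translation -/

/-- The test function `ψ` transported for time `t` along the flow `x ↦ x + t xₙ w`. The prefactor
makes `∂ₜ` of it a divergence. -/
noncomputable def transported (ψ : EuclideanSpace ℝ (Fin n) → ℝ) (w : EuclideanSpace ℝ (Fin n))
    (t : ℝ) (x : EuclideanSpace ℝ (Fin n)) : ℝ :=
  ((1 + t * lastCoord w) ^ (n - 1))⁻¹ * ψ (rightTranslate (t • w) x)

theorem lastCoord_smul (t : ℝ) (w : EuclideanSpace ℝ (Fin n)) :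
    lastCoord (t • w) = t * lastCoord w := rfl

theorem fderiv_transported {ψ : EuclideanSpace ℝ (Fin n) → ℝ} (hψ : ContDiff ℝ 1 ψ)
    (w : EuclideanSpace ℝ (Fin n)) (t : ℝ) (x : EuclideanSpace ℝ (Fin n)) :
    fderiv ℝ (transported ψ w t) x w = ((1 + t * lastCoord w) ^ (n - 1))⁻¹ *
      ((1 + t * lastCoord w) * fderiv ℝ ψ (rightTranslate (t • w) x) w) := by
  have h := (((hψ.differentiable one_ne_zero) (rightTranslate (t • w) x)).hasFDerivAt.comp x
    (rightTranslate (t • w)).hasFDerivAt).const_mul ((1 + t * lastCoord w) ^ (n - 1))⁻¹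
  have h' : HasFDerivAt (transported ψ w t) _ x := h
  rw [h'.fderiv]
  have : rightTranslate (t • w) w = (1 + t * lastCoord w) • w := by
    rw [rightTranslate_apply]; module
  simp [this]

/-- The transport equation: the time derivative is, up to a factor, the divergence of the
transported function times the left-invariant field `x ↦ xₙ w`. -/
theorem hasDerivAt_transported {ψ : EuclideanSpace ℝ (Fin n) → ℝ} (hψ : ContDiff ℝ 1 ψ)
    {w : EuclideanSpace ℝ (Fin n)} {t : ℝ} (ht : 0 < 1 + t * lastCoord w)
    (x : EuclideanSpace ℝ (Fin n)) :
    HasDerivAt (fun s => transported ψ w s x) ((1 + t * lastCoord w)⁻¹ *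
      (lastCoord x * fderiv ℝ (transported ψ w t) x w -
        (n - 1) * lastCoord w * transported ψ w t x)) t := by
  have h1 : HasDerivAt (fun s : ℝ => rightTranslate (s • w) x) (lastCoord x • w) t := by
    have : HasDerivAt (fun s : ℝ => x + lastCoord x • (s • w)) (lastCoord x • ((1 : ℝ) • w)) t :=
      (((hasDerivAt_id t).smul_const w).const_smul (lastCoord x)).const_add x
    rwa [one_smul] at this
  have h2 := ((hψ.differentiable one_ne_zero)
    (rightTranslate (t • w) x)).hasFDerivAt.comp_hasDerivAt t h1
  have h3 : HasDerivAt (fun s : ℝ => 1 + s * lastCoord w) (lastCoord w) t := by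
    simpa using ((hasDerivAt_id t).mul_const (lastCoord w)).const_add 1
  have h4 := ((h3.fun_pow (n - 1)).fun_inv (pow_ne_zero _ ht.ne')).fun_mul h2
  refine h4.congr_deriv ?_
  rw [fderiv_transported hψ]
  unfold transported
  simp only [map_smul, smul_eq_mul, Function.comp]
  obtain ⟨m, hm⟩ : ∃ m, n = m + 1 := ⟨n - 1, (Nat.sub_add_cancel (NeZero.pos n)).symm⟩
  have hm' : n - 1 = m := by omega
  have hn' : (n : ℝ) - 1 = m := by rw [hm]; push_cast; ring
  rw [hm', hn']
  rcases m with _ | m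
  · simp
    field_simp
  · simp only [Nat.add_sub_cancel]
    field_simp
    push_cast
    ring

theorem one_add_mul_lastCoord_bounds {w : EuclideanSpace ℝ (Fin n)} (hw : ‖w‖ ≤ 1 / 2) {t : ℝ}
    (ht : t ∈ Set.Icc (0 : ℝ) 1) : 1 / 2 ≤ 1 + t * lastCoord w := by
  have h := abs_le.1 ((abs_lastCoord_le w).trans hw)
  nlinarith [ht.1, ht.2, h.1]

/-- The time derivative of the pairing of `u` with the transported test function is the pairing of
`u` with a divergence. -/
theorem hasDerivAt_integral_transported {u ψ : EuclideanSpace ℝ (Fin n) → ℝ} {M : ℝ}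
    {w : EuclideanSpace ℝ (Fin n)} (hu : Integrable u (hypVol n))
    (hψ : ContDiff ℝ 1 ψ) (hψc : HasCompactSupport ψ) (hψM : ∀ x, |ψ x| ≤ M)
    (hw : ‖w‖ ≤ 1 / 2) {t : ℝ} (ht : t ∈ Set.Icc (0 : ℝ) 1) :
    HasDerivAt (fun r => ∫ x, u x * transported ψ w r x ∂(hypVol n))
      (∫ x, u x * ((1 + t * lastCoord w)⁻¹ *
      (lastCoord x * fderiv ℝ (transported ψ w t) x w -
        (n - 1) * lastCoord w * transported ψ w t x)) ∂(hypVol n)) t := by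
  have hω := abs_le.1 ((abs_lastCoord_le w).trans hw)
  -- a slightly larger time interval, on which the flow stays nondegenerate
  set s : Set ℝ := Set.Ioo (-1 / 2) (3 / 2)
  have hlow : ∀ t ∈ s, 1 / 4 ≤ 1 + t * lastCoord w := by
    intro t ht
    nlinarith [ht.1, ht.2, hω.1, hω.2]
  have hcont : ∀ t, ContDiff ℝ 1 (transported ψ w t) := fun t =>
    contDiff_const.mul (hψ.comp (rightTranslate (t • w)).contDiff)
  have hdivc : ∀ t, Continuous fun x => (1 + t * lastCoord w)⁻¹ *
      (lastCoord x * fderiv ℝ (transported ψ w t) x w -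
        (n - 1) * lastCoord w * transported ψ w t x) := fun t =>
    continuous_const.mul ((continuous_lastCoord.mul
      (((hcont t).continuous_fderiv one_ne_zero).clm_apply continuous_const)).sub
        (continuous_const.mul (hcont t).continuous))
  obtain ⟨D, hD⟩ : ∃ D, ∀ y, ‖lastCoord y * fderiv ℝ ψ y w‖ ≤ D := by
    have h1 : Continuous fun y => lastCoord y * fderiv ℝ ψ y w :=
      continuous_lastCoord.mul ((hψ.continuous_fderiv one_ne_zero).clm_apply continuous_const)
    have h2 : HasCompactSupport fun y => lastCoord y * fderiv ℝ ψ y w :=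
      (hψc.fderiv_apply (𝕜 := ℝ) w).mul_left
    exact h1.bounded_above_of_compact_support h2
  have hD0 : 0 ≤ D := (norm_nonneg _).trans (hD 0)
  have hn0 : (0 : ℝ) ≤ (n : ℝ) - 1 := by
    have : (1 : ℝ) ≤ n := by exact_mod_cast NeZero.pos n
    linarith
  have hinv : ∀ t ∈ s, (1 + t * lastCoord w)⁻¹ ≤ 4 := fun t ht => by
    rw [inv_le_comm₀ (by linarith [hlow t ht]) (by norm_num)]
    linarith [hlow t ht]
  obtain ⟨Q, hQeq⟩ : ∃ Q : ℝ, Q = 4 ^ (n - 1) := ⟨_, rfl⟩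
  have hinvn : ∀ t ∈ s, ((1 + t * lastCoord w) ^ (n - 1))⁻¹ ≤ Q := fun t ht => by
    have := hlow t ht
    rw [← inv_pow, hQeq]
    exact pow_le_pow_left₀ (by positivity) (hinv t ht) _
  have hQ : 0 ≤ Q := by rw [hQeq]; positivity
  have hts : t ∈ s := ⟨by linarith [ht.1], by linarith [ht.2]⟩
  have hbdd : ∀ r ∈ s, ∀ x, ‖transported ψ w r x‖ ≤ Q * M := by
    intro r hr x
    have := hlow r hr
    unfold transported
    rw [norm_mul, Real.norm_of_nonneg (by positivity)]
    exact mul_le_mul (hinvn r hr) (hψM _) (norm_nonneg _) hQ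
  refine (hasDerivAt_integral_of_dominated_loc_of_deriv_le (μ := hypVol n) (s := s) (x₀ := t)
    (F := fun r x => u x * transported ψ w r x)
    (F' := fun r x => u x * ((1 + r * lastCoord w)⁻¹ *
      (lastCoord x * fderiv ℝ (transported ψ w r) x w -
        (n - 1) * lastCoord w * transported ψ w r x)))
    (bound := fun x => ‖u x‖ * (4 * (Q * D + (n - 1) * 1 * (Q * M))))
    (isOpen_Ioo.mem_nhds hts)
    (Eventually.of_forall fun r =>
      hu.aestronglyMeasurable.mul (hcont r).continuous.aestronglyMeasurable)
    ?_ (hu.aestronglyMeasurable.mul (hdivc t).aestronglyMeasurable) ?_ (hu.norm.mul_const _) ?_).2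
  · exact Integrable.mul_bdd (g := transported ψ w t) hu
      (hcont t).continuous.aestronglyMeasurable (Eventually.of_forall (hbdd t hts))
  · refine Eventually.of_forall fun x r hr => ?_
    have hr4 := hlow r hr
    rw [norm_mul, norm_mul, Real.norm_of_nonneg (show 0 ≤ (1 + r * lastCoord w)⁻¹ by positivity)]
    gcongr
    · exact hinv r hr
    refine (norm_sub_le _ _).trans (add_le_add ?_ ?_)
    · rw [fderiv_transported hψ]
      have := hD (rightTranslate (r • w) x)
      rw [lastCoord_rightTranslate, lastCoord_smul] at this
      calc _ = ‖((1 + r * lastCoord w) ^ (n - 1))⁻¹ * (lastCoord x * (1 + r * lastCoord w) *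
            fderiv ℝ ψ (rightTranslate (r • w) x) w)‖ := by congr 1; ring
        _ ≤ _ := by
          rw [norm_mul, Real.norm_of_nonneg (by positivity)]
          gcongr
          exact hinvn r hr
    · rw [norm_mul, norm_mul, Real.norm_of_nonneg hn0]
      gcongr
      · exact (abs_lastCoord_le w).trans (by linarith)
      · exact hbdd r hr x
  · exact Eventually.of_forall fun x r hr =>
      (hasDerivAt_transported hψ (by linarith [hlow r hr]) x).const_mul (u x)

/-- Moving a bounded test function along a right translation changes its pairing with `u` by at
most a multiple of the variation of `u` and of the length of the translation. -/
theorem abs_integral_transported_sub_le {u ψ : EuclideanSpace ℝ (Fin n) → ℝ} {M ρ : ℝ}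
    {w : EuclideanSpace ℝ (Fin n)} (hu : Integrable u (hypVol n)) (hv : hypVariation u < ∞)
    (hψ : ContDiff ℝ 1 ψ) (hψc : HasCompactSupport ψ) (hψs : tsupport ψ ⊆ hypSpace n)
    (hM : 0 < M) (hψM : ∀ x, |ψ x| ≤ M) (hρ : 0 < ρ) (hwρ : ‖w‖ ≤ ρ) (hρ2 : ρ ≤ 1 / 2) :
    |∫ x, u x * (((1 + lastCoord w) ^ (n - 1))⁻¹ * ψ (rightTranslate w x)) ∂(hypVol n) -
      ∫ x, u x * ψ x ∂(hypVol n)| ≤ 2 ^ n * M * ρ * (hypVariation u).toReal := by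
  have hw : ‖w‖ ≤ 1 / 2 := hwρ.trans hρ2
  have hcont : ∀ t, ContDiff ℝ 1 (transported ψ w t) := fun t =>
    contDiff_const.mul (hψ.comp (rightTranslate (t • w)).contDiff)
  have hmv := norm_image_sub_le_of_norm_deriv_le_segment_01'
    (f := fun r => ∫ x, u x * transported ψ w r x ∂(hypVol n))
    (f' := fun t => ∫ x, u x * ((1 + t * lastCoord w)⁻¹ *
      (lastCoord x * fderiv ℝ (transported ψ w t) x w -
        (n - 1) * lastCoord w * transported ψ w t x)) ∂(hypVol n))
    (C := 2 ^ n * M * ρ * (hypVariation u).toReal)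
    (fun t ht => (hasDerivAt_integral_transported hu hψ hψc hψM hw ht).hasDerivWithinAt) ?_
  · have e0 : ∀ x, transported ψ w 0 x = ψ x := fun x => by
      simp [transported, rightTranslate_apply]
    have e1 : ∀ x, transported ψ w 1 x =
        ((1 + lastCoord w) ^ (n - 1))⁻¹ * ψ (rightTranslate w x) := fun x => by
      simp [transported]
    simpa only [e0, e1, Real.norm_eq_abs] using hmv
  · intro t ht
    have ht' : t ∈ Set.Icc (0 : ℝ) 1 := ⟨ht.1, ht.2.le⟩
    have h2 := one_add_mul_lastCoord_bounds hw ht'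
    have hpos : 0 < 1 + lastCoord (t • w) := by rw [lastCoord_smul]; linarith
    have hi2 : (1 + t * lastCoord w)⁻¹ ≤ 2 := by
      rw [inv_le_comm₀ (by linarith) (by norm_num)]
      linarith
    have hsub : tsupport (transported ψ w t) ⊆
        tsupport fun x => ψ (rightTranslate (t • w) x) := tsupport_mul_subset_right
    have hK : (0 : ℝ) < 2 ^ (n - 1) * M * ρ := by positivity
    have key := abs_integral_mul_divergence_le (u := u) (f := transported ψ w t) (w := w) hv hK
      (hcont t) (hasCompactSupport_comp_rightTranslate hpos hψc).mul_left
      (hsub.trans (tsupport_comp_rightTranslate_subset hpos hψs)) (fun x => by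
        unfold transported
        rw [abs_mul, abs_of_pos (show 0 < ((1 + t * lastCoord w) ^ (n - 1))⁻¹ by positivity)]
        gcongr
        · rw [← inv_pow]
          exact pow_le_pow_left₀ (by positivity) hi2 _
        · exact hψM _)
    have e : ∀ x, u x * ((1 + t * lastCoord w)⁻¹ *
        (lastCoord x * fderiv ℝ (transported ψ w t) x w -
        (n - 1) * lastCoord w * transported ψ w t x)) = (1 + t * lastCoord w)⁻¹ *
        (u x * (lastCoord x * fderiv ℝ (transported ψ w t) x w -
        (n - 1) * lastCoord w * transported ψ w t x)) := fun x => by ring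
    simp only [e]
    rw [integral_const_mul, norm_mul, Real.norm_of_nonneg (by positivity)]
    calc _ ≤ 2 * (2 ^ (n - 1) * M * ρ * (hypVariation u).toReal) := by
          gcongr
          exact key
      _ = 2 ^ n * M * ρ * (hypVariation u).toReal := by
        obtain ⟨m, hm⟩ : ∃ m, n = m + 1 := ⟨n - 1, (Nat.sub_add_cancel (NeZero.pos n)).symm⟩
        have hm' : n - 1 = m := by omega
        rw [hm', show (2 : ℝ) ^ n = 2 ^ (m + 1) by rw [← hm]]
        ring

/-! ### Smooth approximation -/

/-- A bounded function is the almost everywhere limit, on the half-space, of test functions with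
the same bound: mollify, then cut off. -/
theorem exists_seq_contDiff_tendsto_ae {u : EuclideanSpace ℝ (Fin n) → ℝ} {M : ℝ}
    (hu : Measurable u) (huM : ∀ x, |u x| ≤ M) :
    ∃ ψ : ℕ → EuclideanSpace ℝ (Fin n) → ℝ,
      (∀ k, ContDiff ℝ 1 (ψ k) ∧ HasCompactSupport (ψ k) ∧ tsupport (ψ k) ⊆ hypSpace n ∧
        ∀ x, |ψ k x| ≤ M) ∧
      ∀ᵐ x ∂(volume : Measure (EuclideanSpace ℝ (Fin n))), x ∈ hypSpace n →
        Tendsto (fun k => ψ k x) atTop (𝓝 (u x)) := by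
  have hM : 0 ≤ M := (abs_nonneg _).trans (huM 0)
  let b : ℕ → ContDiffBump (0 : EuclideanSpace ℝ (Fin n)) := fun k =>
    ⟨1 / ((k : ℝ) + 1), 2 * (1 / ((k : ℝ) + 1)), by positivity,
      by linarith [show (0 : ℝ) < 1 / ((k : ℝ) + 1) by positivity]⟩
  have hloc : LocallyIntegrable u volume := by
    have h : LocallyIntegrable (fun _ => M) (volume : Measure (EuclideanSpace ℝ (Fin n))) :=
      locallyIntegrable_const M
    exact h.mono hu.aestronglyMeasurable (Eventually.of_forall fun x => by
      rw [Real.norm_of_nonneg hM]; exact huM x)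
  set v : ℕ → EuclideanSpace ℝ (Fin n) → ℝ := fun k =>
    (convolution ((b k).normed volume) u (ContinuousLinearMap.lsmul ℝ ℝ) volume) with hv
  have hvM : ∀ k x, |v k x| ≤ M := by
    intro k x
    calc |v k x| ≤ ∫ t, (b k).normed volume t * M := by
          refine norm_integral_le_of_norm_le (G := ℝ)
            (((b k).integrable_normed (μ := volume)).mul_const M) (Eventually.of_forall fun t => ?_)
          simp only [ContinuousLinearMap.lsmul_apply, smul_eq_mul, norm_mul]
          rw [Real.norm_of_nonneg ((b k).nonneg_normed t)]
          gcongr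
          · exact (b k).nonneg_normed t
          · exact huM _
      _ = M := by rw [integral_mul_const, (b k).integral_normed, one_mul]
  have hvc : ∀ k, ContDiff ℝ 1 (v k) := fun k =>
    (b k).hasCompactSupport_normed.contDiff_convolution_left _ (b k).contDiff_normed hloc
  have hvt : ∀ᵐ x, Tendsto (fun k => v k x) atTop (𝓝 (u x)) := by
    refine ContDiffBump.ae_convolution_tendsto_right_of_locallyIntegrable (φ := b) (K := 2) ?_
      (Eventually.of_forall fun k => le_rfl) hloc
    have := (tendsto_one_div_add_atTop_nhds_zero_nat (𝕜 := ℝ)).const_mul 2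
    rwa [mul_zero] at this
  refine ⟨fun k x => hypCutoff k x * v k x, fun k => ⟨(contDiff_hypCutoff k).mul (hvc k),
    (hasCompactSupport_hypCutoff k).mul_right, ?_, fun x => ?_⟩, ?_⟩
  · exact (tsupport_mul_subset_left (f := hypCutoff k)).trans
      (tsupport_hypCutoff_subset_hypSpace k)
  · rw [abs_mul, abs_of_nonneg (hypCutoff_nonneg k x)]
    calc _ ≤ 1 * M := mul_le_mul (hypCutoff_le_one k x) (hvM k x) (abs_nonneg _) zero_le_one
      _ = M := one_mul M
  · filter_upwards [hvt] with x hx hxH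
    refine hx.congr' ?_
    filter_upwards [eventually_hypCutoff_eventuallyEq_one hxH] with k hk
    rw [hk.self_of_nhds, one_mul]

/-- The translation estimate tested with `u` itself, by approximation. -/
theorem integral_sq_le_add {u : EuclideanSpace ℝ (Fin n) → ℝ} {M ρ : ℝ}
    {w : EuclideanSpace ℝ (Fin n)} (hum : Measurable u) (hu : Integrable u (hypVol n))
    (hv : hypVariation u < ∞) (hM : 0 < M) (hu0 : ∀ x, 0 ≤ u x) (huM : ∀ x, u x ≤ M)
    (hρ : 0 < ρ) (hwρ : ‖w‖ ≤ ρ) (hρ2 : ρ ≤ 1 / 2) :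
    ∫ x, u x ^ 2 ∂(hypVol n) ≤ 2 ^ n * M * ρ * (hypVariation u).toReal +
      2 ^ n * ∫ x, u x * u (rightTranslate w x) ∂(hypVol n) := by
  have habs : ∀ x, |u x| ≤ M := fun x => by rw [abs_of_nonneg (hu0 x)]; exact huM x
  obtain ⟨ψ, hψ, hψt⟩ := exists_seq_contDiff_tendsto_ae hum habs
  have h2 := one_add_mul_lastCoord_bounds (hwρ.trans hρ2) (t := 1) (by simp)
  rw [one_mul] at h2
  have hpos : 0 < 1 + lastCoord w := by linarith
  set c := ((1 + lastCoord w) ^ (n - 1))⁻¹ with hc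
  have hc0 : 0 ≤ c := by positivity
  have hc2 : c ≤ 2 ^ n := by
    have hi2 : (1 + lastCoord w)⁻¹ ≤ 2 := by
      rw [inv_le_comm₀ (by linarith) (by norm_num)]
      linarith
    rw [hc, ← inv_pow]
    exact (pow_le_pow_left₀ (by positivity) hi2 _).trans
      (pow_le_pow_right₀ (by norm_num) (Nat.sub_le _ _))
  have hψt' := (quasiMeasurePreserving_rightTranslate hpos).ae hψt
  have l1 : Tendsto (fun k => ∫ x, u x * ψ k x ∂(hypVol n)) atTop
      (𝓝 (∫ x, u x * u x ∂(hypVol n))) := by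
    refine tendsto_integral_of_dominated_convergence (fun x => ‖u x‖ * M)
      (fun k => hu.aestronglyMeasurable.mul (hψ k).1.continuous.aestronglyMeasurable)
      (hu.norm.mul_const M) (fun k => Eventually.of_forall fun x => ?_) ?_
    · rw [norm_mul]
      gcongr
      exact (hψ k).2.2.2 x
    · filter_upwards [ae_mem_hypSpace, hypVol_absolutelyContinuous.ae_le hψt] with x hx hxt
      exact (hxt hx).const_mul _
  have l2 : Tendsto (fun k => ∫ x, u x * (c * ψ k (rightTranslate w x)) ∂(hypVol n)) atTop
      (𝓝 (∫ x, u x * (c * u (rightTranslate w x)) ∂(hypVol n))) := by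
    refine tendsto_integral_of_dominated_convergence (fun x => ‖u x‖ * (c * M))
      (fun k => hu.aestronglyMeasurable.mul (continuous_const.mul
        ((hψ k).1.continuous.comp (rightTranslate w).continuous)).aestronglyMeasurable)
      (hu.norm.mul_const _) (fun k => Eventually.of_forall fun x => ?_) ?_
    · rw [norm_mul, norm_mul, Real.norm_of_nonneg hc0]
      gcongr
      exact (hψ k).2.2.2 _
    · filter_upwards [ae_mem_hypSpace, hypVol_absolutelyContinuous.ae_le hψt'] with x hx hxt
      exact ((hxt ((rightTranslate_mem_hypSpace hpos).2 hx)).const_mul c).const_mul _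
  have hle := le_of_tendsto (l2.sub l1).abs (Eventually.of_forall fun k =>
    abs_integral_transported_sub_le hu hv (hψ k).1 (hψ k).2.1 (hψ k).2.2.1 hM (hψ k).2.2.2 hρ
      hwρ hρ2)
  have e : ∫ x, u x * (c * u (rightTranslate w x)) ∂(hypVol n) =
      c * ∫ x, u x * u (rightTranslate w x) ∂(hypVol n) := by
    rw [← integral_const_mul]
    exact integral_congr_ae (Eventually.of_forall fun x => by ring)
  have h0 : 0 ≤ ∫ x, u x * u (rightTranslate w x) ∂(hypVol n) :=
    integral_nonneg fun x => mul_nonneg (hu0 _) (hu0 _)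
  have := mul_le_mul_of_nonneg_right hc2 h0
  rw [e] at hle
  simp only [pow_two]
  linarith [neg_abs_le (c * ∫ x, u x * u (rightTranslate w x) ∂(hypVol n) -
    ∫ x, u x * u x ∂(hypVol n))]

/-! ### The energy bounds small-scale correlations -/

theorem one_add_sq_half_le_cosh (d : ℝ) : 1 + d ^ 2 / 2 ≤ Real.cosh d := by
  have h : ∀ s : ℝ, 0 ≤ s → 1 + (2 * s) ^ 2 / 2 ≤ Real.cosh (2 * s) := by
    intro s hs
    rw [Real.cosh_two_mul, Real.cosh_sq']
    have := pow_le_pow_left₀ hs (Real.self_le_sinh_iff.2 hs) 2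
    linarith
  have := h (|d| / 2) (by positivity)
  rw [mul_div_cancel₀ _ (two_ne_zero), sq_abs, Real.cosh_abs] at this
  exact this

theorem hypDist_pos {x y : EuclideanSpace ℝ (Fin n)} (hx : x ∈ hypSpace n) (hy : y ∈ hypSpace n)
    (hxy : x ≠ y) : 0 < hypDist x y := by
  have hx' : 0 < lastCoord x := hx
  have hy' : 0 < lastCoord y := hy
  have : 0 < ‖x - y‖ := norm_pos_iff.2 (sub_ne_zero.2 hxy)
  have h : 0 < ‖x - y‖ ^ 2 / (2 * lastCoord x * lastCoord y) := by positivity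
  exact Real.arcosh_pos (by linarith)

theorem half_lastCoord_le {x y : EuclideanSpace ℝ (Fin n)} (hy : y ∈ hypSpace n) {r : ℝ}
    (hr2 : r ≤ 1 / 2) (hxy : ‖x - y‖ ≤ r * lastCoord y) : lastCoord y / 2 ≤ lastCoord x ∧
      lastCoord x ≤ 2 * lastCoord y := by
  have hy' : 0 < lastCoord y := hy
  have h : |lastCoord x - lastCoord y| ≤ ‖x - y‖ := abs_lastCoord_le (x - y)
  have := abs_le.1 h
  constructor <;> nlinarith [this.1, this.2]

theorem hypDist_le_two_mul {x y : EuclideanSpace ℝ (Fin n)} (hy : y ∈ hypSpace n) {r : ℝ}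
    (hr : 0 < r) (hr2 : r ≤ 1 / 2) (hxy : ‖x - y‖ ≤ r * lastCoord y) : hypDist x y ≤ 2 * r := by
  have hy' : 0 < lastCoord y := hy
  have hx := (half_lastCoord_le hy hr2 hxy).1
  have hx' : 0 < lastCoord x := by linarith
  have h1 : ‖x - y‖ ^ 2 / (2 * lastCoord x * lastCoord y) ≤ r ^ 2 := by
    rw [div_le_iff₀ (by positivity)]
    calc ‖x - y‖ ^ 2 ≤ (r * lastCoord y) ^ 2 := by gcongr
      _ = r ^ 2 * (2 * (lastCoord y / 2) * lastCoord y) := by ring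
      _ ≤ _ := by gcongr
  have h0 : 0 ≤ ‖x - y‖ ^ 2 / (2 * lastCoord x * lastCoord y) := by positivity
  have h2 := one_add_sq_half_le_cosh (hypDist x y)
  have h3 : Real.cosh (hypDist x y) = 1 + ‖x - y‖ ^ 2 / (2 * lastCoord x * lastCoord y) :=
    Real.cosh_arcosh (by linarith)
  have h4 : hypDist x y ^ 2 ≤ (2 * r) ^ 2 := by nlinarith
  exact le_of_sq_le_sq h4 (by positivity)

theorem measurable_hypDist (y : EuclideanSpace ℝ (Fin n)) :
    Measurable fun x : EuclideanSpace ℝ (Fin n) => hypDist x y := by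
  have h : Measurable fun x : EuclideanSpace ℝ (Fin n) =>
      1 + ‖x - y‖ ^ 2 / (2 * lastCoord x * lastCoord y) := by
    have := (continuous_lastCoord (n := n)).measurable
    fun_prop
  unfold hypDist Real.arcosh
  fun_prop

/-- The Euclidean ball of translations `w` sweeps out the ball of radius `r yₙ` around `y`. -/
theorem lintegral_ball_comp_rightTranslate {h : EuclideanSpace ℝ (Fin n) → ℝ≥0∞}
    (hh : Measurable h) {y : EuclideanSpace ℝ (Fin n)} (hy : y ∈ hypSpace n) (r : ℝ) :
    ∫⁻ w in Metric.ball 0 r, h (rightTranslate w y) =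
      ENNReal.ofReal ((lastCoord y ^ n)⁻¹) *
        ∫⁻ x in Metric.ball y (r * lastCoord y), h x := by
  have hy' : 0 < lastCoord y := hy
  rw [← lintegral_indicator Metric.isOpen_ball.measurableSet,
    ← lintegral_indicator Metric.isOpen_ball.measurableSet]
  set g := (Metric.ball y (r * lastCoord y)).indicator h with hg
  have hgm : Measurable g := hh.indicator Metric.isOpen_ball.measurableSet
  have e : ∀ w, (Metric.ball 0 r).indicator (fun w => h (rightTranslate w y)) w =
      g (y + lastCoord y • w) := by
    intro w
    have : y + lastCoord y • w ∈ Metric.ball y (r * lastCoord y) ↔ w ∈ Metric.ball 0 r := by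
      rw [mem_ball_iff_norm, add_sub_cancel_left, norm_smul, Real.norm_of_nonneg hy'.le,
        mem_ball_zero_iff, mul_comm, mul_lt_mul_iff_left₀ hy']
    by_cases hw : w ∈ Metric.ball 0 r
    · rw [Set.indicator_of_mem hw, hg, Set.indicator_of_mem (this.2 hw), rightTranslate_apply]
    · rw [Set.indicator_of_notMem hw, hg, Set.indicator_of_notMem (fun hc => hw (this.1 hc))]
  simp only [e]
  have h1 := lintegral_map (μ := (volume : Measure (EuclideanSpace ℝ (Fin n))))
    (f := fun z => g (y + z)) (g := fun w => lastCoord y • w)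
    (hgm.comp (measurable_const_add y)) (measurable_const_smul _)
  rw [← h1, Measure.map_addHaar_smul _ hy'.ne', lintegral_smul_measure,
    lintegral_add_left_eq_self g y, finrank_euclideanSpace_fin, abs_of_pos (by positivity),
    smul_eq_mul]

/-- Translations of length `r` move `y` by a hyperbolic distance of at most `2 r`, so the kernel
`d⁻ᵅ` is at least `(2 r)⁻ᵅ` on the region swept out. -/
theorem lintegral_ball_correlation_le {u : EuclideanSpace ℝ (Fin n) → ℝ} {α r : ℝ}
    (hum : Measurable u) (hu0 : ∀ x, 0 ≤ u x) (hα : 0 < α) (hr : 0 < r) (hr2 : r ≤ 1 / 2)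
    {y : EuclideanSpace ℝ (Fin n)} (hy : y ∈ hypSpace n) :
    ∫⁻ w in Metric.ball 0 r, ENNReal.ofReal (u y * u (rightTranslate w y)) ≤
      ENNReal.ofReal (2 ^ n * (2 * r) ^ α) *
        ∫⁻ x, ENNReal.ofReal (u x * u y / hypDist x y ^ α) ∂(hypVol n) := by
  have hy' : 0 < lastCoord y := hy
  have hm : Measurable fun x => ENNReal.ofReal (u x * u y / hypDist x y ^ α) := by
    have := measurable_hypDist y
    fun_prop
  have hm1 : Measurable fun x => ENNReal.ofReal (u y * u x) := by fun_prop
  rw [lintegral_ball_comp_rightTranslate hm1 hy]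
  unfold hypVol
  rw [lintegral_withDensity_eq_lintegral_mul _ measurable_hypDensity hm,
    ← lintegral_const_mul _ hm1, ← lintegral_const_mul _ (measurable_hypDensity.mul hm)]
  have hsub : Metric.ball y (r * lastCoord y) ⊆ hypSpace n := fun x hx =>
    lt_of_lt_of_le (by positivity)
      (half_lastCoord_le hy hr2 (mem_ball_iff_norm.1 hx).le).1
  refine le_trans ?_ (lintegral_mono_set hsub)
  refine lintegral_mono_ae ?_
  filter_upwards [ae_restrict_mem Metric.isOpen_ball.measurableSet,
    ae_restrict_of_ae (Measure.ae_ne (volume : Measure (EuclideanSpace ℝ (Fin n))) y)]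
    with x hx hxy
  have hxr := (mem_ball_iff_norm.1 hx).le
  have hxH := hsub hx
  have hx' : 0 < lastCoord x := hxH
  have hd := hypDist_pos hxH hy hxy
  simp only [Pi.mul_apply]
  have hu2 : 0 ≤ u x * u y := mul_nonneg (hu0 x) (hu0 y)
  rw [← ENNReal.ofReal_mul (by positivity), ← ENNReal.ofReal_mul (by positivity),
    ← ENNReal.ofReal_mul (by positivity)]
  apply ENNReal.ofReal_le_ofReal
  have hdα : 0 < hypDist x y ^ α := Real.rpow_pos_of_pos hd α
  have h1 : hypDist x y ^ α ≤ (2 * r) ^ α :=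
    Real.rpow_le_rpow hd.le (hypDist_le_two_mul hy hr hr2 hxr) hα.le
  have h2 : (lastCoord y ^ n)⁻¹ ≤ 2 ^ n * (lastCoord x ^ n)⁻¹ := by
    rw [← div_eq_mul_inv, inv_le_comm₀ (by positivity) (by positivity), inv_div,
      div_le_iff₀ (by positivity), ← mul_pow]
    exact pow_le_pow_left₀ hx'.le (by linarith [(half_lastCoord_le hy hr2 hxr).2]) n
  have h3 : u x * u y ≤ (2 * r) ^ α * (u x * u y / hypDist x y ^ α) := by
    rw [mul_div_assoc', le_div_iff₀ hdα, mul_comm]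
    gcongr
  calc (lastCoord y ^ n)⁻¹ * (u y * u x)
      = (lastCoord y ^ n)⁻¹ * (u x * u y) := by ring
    _ ≤ (2 ^ n * (lastCoord x ^ n)⁻¹) * ((2 * r) ^ α * (u x * u y / hypDist x y ^ α)) := by
      gcongr
    _ = _ := by ring

theorem lintegral_ball_lintegral_correlation_le {u : EuclideanSpace ℝ (Fin n) → ℝ} {α r : ℝ}
    (hum : Measurable u) (hu0 : ∀ x, 0 ≤ u x) (hα : 0 < α) (hr : 0 < r) (hr2 : r ≤ 1 / 2) :
    ∫⁻ w in Metric.ball 0 r, ∫⁻ x, ENNReal.ofReal (u x * u (rightTranslate w x)) ∂(hypVol n) ≤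
      ENNReal.ofReal (2 ^ n * (2 * r) ^ α) * hypEnergy α u := by
  have hl := (continuous_lastCoord (n := n)).measurable
  have hm : Measurable (Function.uncurry fun (w x : EuclideanSpace ℝ (Fin n)) =>
      ENNReal.ofReal (u x * u (rightTranslate w x))) := by
    simp only [rightTranslate_apply]
    fun_prop
  rw [lintegral_lintegral_swap hm.aemeasurable]
  unfold hypEnergy
  rw [← lintegral_const_mul' _ _ ENNReal.ofReal_ne_top]
  refine lintegral_mono_ae ?_
  filter_upwards [ae_mem_hypSpace] with y hy
  exact lintegral_ball_correlation_le hum hu0 hα hr hr2 hy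

/-! ### The interpolation inequality -/

/-- The interpolation inequality at a fixed scale `r`: average the translation estimate over the
ball of radius `r`. -/
theorem exists_integral_sq_le_radius (n : ℕ) [NeZero n] {α : ℝ} (hα : 0 < α) :
    ∃ C : ℝ, 1 ≤ C ∧ ∀ (u : EuclideanSpace ℝ (Fin n) → ℝ) (M r : ℝ), Measurable u →
      Integrable u (hypVol n) → hypVariation u < ∞ → 0 < M → (∀ x, 0 ≤ u x) → (∀ x, u x ≤ M) →
      hypEnergy α u < ∞ → 0 < r → r ≤ 1 / 2 →
      ∫ x, u x ^ 2 ∂(hypVol n) ≤ C * (r * (M * (hypVariation u).toReal) +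
        r ^ (-((n : ℝ) - α)) * (hypEnergy α u).toReal) := by
  set v₁ := (volume : Measure (EuclideanSpace ℝ (Fin n))).real (Metric.ball 0 1) with hv₁
  have hv₁0 : 0 < v₁ := ENNReal.toReal_pos (Metric.measure_ball_pos _ _ one_pos).ne'
    measure_ball_lt_top.ne
  refine ⟨2 ^ n + 2 ^ n * (2 ^ n * 2 ^ α) / v₁, ?_, ?_⟩
  · have h1 : (1 : ℝ) ≤ 2 ^ n := one_le_pow₀ (by norm_num)
    have h2 : 0 ≤ (2 : ℝ) ^ n * (2 ^ n * 2 ^ α) / v₁ := by positivity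
    linarith
  intro u M r hum hu hv hM hu0 huM hE hr hr2
  set A := ∫ x, u x ^ 2 ∂(hypVol n) with hA
  set T := (hypVariation u).toReal with hT
  set V := (volume : Measure (EuclideanSpace ℝ (Fin n))) (Metric.ball 0 r) with hV
  have hT0 : 0 ≤ T := ENNReal.toReal_nonneg
  have hVr : V = ENNReal.ofReal (r ^ n * v₁) := by
    rw [hV, Measure.addHaar_ball _ _ hr.le, finrank_euclideanSpace_fin,
      ENNReal.ofReal_mul (by positivity), hv₁, ofReal_measureReal measure_ball_lt_top.ne]
  have hpt : ∀ w ∈ Metric.ball (0 : EuclideanSpace ℝ (Fin n)) r, ENNReal.ofReal A ≤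
      ENNReal.ofReal (2 ^ n * M * r * T) + ENNReal.ofReal (2 ^ n) *
        ∫⁻ x, ENNReal.ofReal (u x * u (rightTranslate w x)) ∂(hypVol n) := by
    intro w hw
    have h := integral_sq_le_add hum hu hv hM hu0 huM hr (mem_ball_zero_iff.1 hw).le hr2
    have hint : Integrable (fun x => u x * u (rightTranslate w x)) (hypVol n) :=
      Integrable.mul_bdd (c := M) hu
        (hum.comp (rightTranslate w).continuous.measurable).aestronglyMeasurable
        (Eventually.of_forall fun x => by
          rw [Real.norm_of_nonneg (hu0 _)]; exact huM _)
    have h0 : 0 ≤ᵐ[hypVol n] fun x => u x * u (rightTranslate w x) :=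
      Eventually.of_forall fun x => mul_nonneg (hu0 _) (hu0 _)
    rw [← ofReal_integral_eq_lintegral_ofReal hint h0, ← ENNReal.ofReal_mul (by positivity),
      ← ENNReal.ofReal_add (by positivity)
        (mul_nonneg (by positivity) (integral_nonneg_of_ae h0))]
    exact ENNReal.ofReal_le_ofReal h
  have hm : Measurable fun w =>
      ∫⁻ x, ENNReal.ofReal (u x * u (rightTranslate w x)) ∂(hypVol n) := by
    have hl := (continuous_lastCoord (n := n)).measurable
    have hm : Measurable (Function.uncurry fun (w x : EuclideanSpace ℝ (Fin n)) =>
        ENNReal.ofReal (u x * u (rightTranslate w x))) := by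
      simp only [rightTranslate_apply]
      fun_prop
    exact hm.lintegral_prod_right'
  have hint := setLIntegral_mono' (μ := volume) Metric.isOpen_ball.measurableSet hpt
  rw [setLIntegral_const, lintegral_add_left measurable_const, setLIntegral_const,
    lintegral_const_mul _ hm] at hint
  have hfin := hint.trans (add_le_add_right (mul_le_mul_right
    (lintegral_ball_lintegral_correlation_le hum hu0 hα hr hr2) _) _)
  rw [← ENNReal.ofReal_toReal hE.ne, ← hV, hVr] at hfin
  have hV0 : 0 < r ^ n * v₁ := by positivity
  set E := (hypEnergy α u).toReal with hEE
  have hE0 : 0 ≤ E := ENNReal.toReal_nonneg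
  rw [← ENNReal.ofReal_mul' hV0.le, ← ENNReal.ofReal_mul' hV0.le,
    ← ENNReal.ofReal_mul (by positivity), ← ENNReal.ofReal_mul (by positivity),
    ← ENNReal.ofReal_add (by positivity) (by positivity),
    ENNReal.ofReal_le_ofReal_iff (by positivity), ← le_div_iff₀ hV0] at hfin
  refine hfin.trans ?_
  have hrα : r ^ (-((n : ℝ) - α)) = r ^ α / r ^ n := by
    rw [neg_sub, Real.rpow_sub hr, Real.rpow_natCast]
  rw [hrα, Real.mul_rpow (by norm_num) hr.le]
  have e : (2 ^ n * M * r * T * (r ^ n * v₁) + 2 ^ n * (2 ^ n * (2 ^ α * r ^ α) * E)) /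
      (r ^ n * v₁) = 2 ^ n * (r * (M * T)) +
        2 ^ n * (2 ^ n * 2 ^ α) / v₁ * (r ^ α / r ^ n * E) := by
    field_simp
  rw [e]
  have p1 : 0 ≤ 2 ^ n * (r ^ α / r ^ n * E) := by positivity
  have p2 : 0 ≤ 2 ^ n * (2 ^ n * 2 ^ α) / v₁ * (r * (M * T)) := by positivity
  linarith

/-- The interpolation inequality for measurable functions with pointwise bounds. The scales
`r ≤ 1 / 2` suffice: when the balancing radius is larger, the linear isoperimetric inequality
takes over. -/
theorem exists_lintegral_sq_le_of_measurable (n : ℕ) [NeZero n] (hn : 2 ≤ n) {α : ℝ} (hα : 0 < α)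
    (hαn : α < n) :
    ∃ c : ℝ≥0, ∀ (u : EuclideanSpace ℝ (Fin n) → ℝ) (M : ℝ), Measurable u →
      Integrable u (hypVol n) → hypVariation u < ∞ → 0 < M → (∀ x, 0 ≤ u x) → (∀ x, u x ≤ M) →
      ∫⁻ x, ENNReal.ofReal (u x ^ 2) ∂(hypVol n) ≤
          c * ENNReal.ofReal M ^ ((n - α) / (n + 1 - α)) *
            hypVariation u ^ ((n - α) / (n + 1 - α)) *
            hypEnergy α u ^ (1 / (n + 1 - α)) := by
  obtain ⟨C, hC1, hC⟩ := exists_integral_sq_le_radius n hα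
  refine ⟨(2 * C).toNNReal, fun u M hum hu hv hM hu0 huM => ?_⟩
  have hβ : 0 < (n : ℝ) - α := by linarith
  have hd : (n : ℝ) + 1 - α = (n - α) + 1 := by ring
  rw [hd]
  have hp : 0 < ((n : ℝ) - α) / ((n - α) + 1) := by positivity
  have hq : 0 < 1 / (((n : ℝ) - α) + 1) := by positivity
  have hint : Integrable (fun x => u x ^ 2) (hypVol n) := by
    simp only [pow_two]
    exact Integrable.mul_bdd (c := M) hu hum.aestronglyMeasurable
      (Eventually.of_forall fun x => by rw [Real.norm_of_nonneg (hu0 _)]; exact huM _)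
  rw [← ofReal_integral_eq_lintegral_ofReal hint (Eventually.of_forall fun x => sq_nonneg _)]
  set T := (hypVariation u).toReal with hT
  have hT0 : 0 ≤ T := ENNReal.toReal_nonneg
  have hMT : ∫ x, u x ^ 2 ∂(hypVol n) ≤ M * T := by
    refine le_trans ?_ (mul_le_mul_of_nonneg_left (integral_le_hypVariation hn hu hu0 hv) hM.le)
    rw [← integral_const_mul]
    refine integral_mono hint (hu.const_mul M) fun x => ?_
    simp only [pow_two]
    exact mul_le_mul_of_nonneg_right (huM x) (hu0 x)
  rw [← ENNReal.ofReal_toReal hv.ne, ← hT]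
  by_cases hE : hypEnergy α u = ∞
  · -- the right side is infinite unless the variation vanishes, and then so does `u`
    rcases hT0.eq_or_lt with h | h
    · rw [← h, mul_zero] at hMT
      rw [ENNReal.ofReal_of_nonpos hMT]
      exact zero_le
    · rw [hE, ENNReal.top_rpow_of_pos hq, ENNReal.mul_top]
      · exact le_top
      · refine mul_ne_zero (mul_ne_zero ?_ ?_) ?_
        · exact ENNReal.coe_ne_zero.2 (Real.toNNReal_pos.2 (by linarith)).ne'
        · exact (ENNReal.rpow_pos (ENNReal.ofReal_pos.2 hM) ENNReal.ofReal_ne_top).ne'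
        · exact (ENNReal.rpow_pos (ENNReal.ofReal_pos.2 h) ENNReal.ofReal_ne_top).ne'
  · have hMT0 : 0 ≤ M * T := by positivity
    have h := le_mul_rpow_mul_rpow_of_forall_radius hMT0
      (ENNReal.toReal_nonneg (a := hypEnergy α u)) (by linarith) hβ
      (hMT.trans (le_mul_of_one_le_left hMT0 hC1))
      (fun r hr hr2 => hC u M r hum hu hv hM hu0 huM (lt_top_iff_ne_top.2 hE) hr hr2)
    rw [Real.mul_rpow hM.le hT0] at h
    refine (ENNReal.ofReal_le_ofReal h).trans (le_of_eq ?_)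
    have hMp := Real.rpow_nonneg hM.le (((n : ℝ) - α) / ((n - α) + 1))
    have hTp := Real.rpow_nonneg hT0 (((n : ℝ) - α) / ((n - α) + 1))
    rw [ENNReal.ofReal_mul (show 0 ≤ 2 * C by linarith), ENNReal.ofReal_mul (mul_nonneg hMp hTp),
      ENNReal.ofReal_mul hMp, ← ENNReal.ofReal_rpow_of_nonneg hM.le hp.le,
      ← ENNReal.ofReal_rpow_of_nonneg hT0 hp.le,
      ← ENNReal.ofReal_rpow_of_nonneg ENNReal.toReal_nonneg hq.le, ENNReal.ofReal_toReal hE]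
    rw [← mul_assoc, ← mul_assoc]
    rfl

theorem hypVariation_congr_ae {u v : EuclideanSpace ℝ (Fin n) → ℝ} (h : u =ᵐ[hypVol n] v) :
    hypVariation u = hypVariation v := by
  unfold hypVariation
  refine iSup_congr fun X => iSup_congr fun _ => ?_
  congr 1
  refine integral_congr_ae ?_
  filter_upwards [h] with x hx
  rw [hx]

theorem hypEnergy_congr_ae {α : ℝ} {u v : EuclideanSpace ℝ (Fin n) → ℝ}
    (h : u =ᵐ[hypVol n] v) : hypEnergy α u = hypEnergy α v := by
  unfold hypEnergy
  refine lintegral_congr_ae ?_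
  filter_upwards [h] with y hy
  refine lintegral_congr_ae ?_
  filter_upwards [h] with x hx
  rw [hx, hy]

theorem hypVariation_indicator_one {F : Set (EuclideanSpace ℝ (Fin n))}
    (hF : NullMeasurableSet F (hypVol n)) :
    hypVariation (F.indicator fun _ => (1 : ℝ)) = hypPerimeter F := by
  unfold hypVariation hypPerimeter
  refine iSup_congr fun X => iSup_congr fun _ => ?_
  rw [← integral_indicator₀ hF]
  congr 2
  funext x
  by_cases hx : x ∈ F <;> simp [hx]

theorem exists_lintegral_sq_le (n : ℕ) [NeZero n] (hn : 2 ≤ n) {α : ℝ} (hα : 0 < α)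
    (hαn : α < n) :
    ∃ c : ℝ≥0, ∀ u : EuclideanSpace ℝ (Fin n) → ℝ,
      HypBV u → MemLp u ∞ (hypVol n) → (∀ᵐ x ∂(hypVol n), 0 ≤ u x) →
        ∫⁻ x, ENNReal.ofReal (u x ^ 2) ∂(hypVol n) ≤
          c * eLpNorm u ∞ (hypVol n) ^ ((n - α) / (n + 1 - α)) *
            hypVariation u ^ ((n - α) / (n + 1 - α)) *
            hypEnergy α u ^ (1 / (n + 1 - α)) := by
  obtain ⟨c, hc⟩ := exists_lintegral_sq_le_of_measurable n hn hα hαn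
  refine ⟨c, fun u hBV hmem hu0 => ?_⟩
  set M := (eLpNorm u ∞ (hypVol n)).toReal with hM
  have hMtop : ENNReal.ofReal M = eLpNorm u ∞ (hypVol n) := ENNReal.ofReal_toReal hmem.2.ne
  have hle : ∀ᵐ x ∂(hypVol n), |u x| ≤ M := by
    have h : ∀ᵐ x ∂(hypVol n), ‖u x‖ₑ ≤ eLpNorm u ∞ (hypVol n) := by
      rw [eLpNorm_exponent_top]
      exact enorm_ae_le_eLpNormEssSup u (hypVol n)
    filter_upwards [h] with x hx
    rw [← hMtop, ← ofReal_norm,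
      ENNReal.ofReal_le_ofReal_iff ENNReal.toReal_nonneg] at hx
    exact hx
  -- `u` vanishes almost everywhere if its essential supremum does
  rcases (ENNReal.toReal_nonneg (a := eLpNorm u ∞ (hypVol n))).eq_or_lt with h0 | hpos
  · have : ∫⁻ x, ENNReal.ofReal (u x ^ 2) ∂(hypVol n) = 0 := by
      rw [← lintegral_zero (μ := hypVol n)]
      refine lintegral_congr_ae ?_
      filter_upwards [hle] with x hx
      rw [hM, ← h0] at hx
      simp [abs_nonpos_iff.1 hx]
    rw [this]
    exact zero_le
  -- a measurable representative with the bounds everywhere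
  set g := hmem.1.mk u with hg
  have hgm : Measurable g := hmem.1.stronglyMeasurable_mk.measurable
  set u' : EuclideanSpace ℝ (Fin n) → ℝ := fun x => max 0 (min (g x) M) with hu'
  have hae : u =ᵐ[hypVol n] u' := by
    filter_upwards [hle, hu0, hmem.1.ae_eq_mk] with x h1 h2 h3
    rw [hu']
    simp only
    rw [hg, ← h3, min_eq_left ((le_abs_self _).trans h1), max_eq_right h2]
  have hm' : Measurable u' := measurable_const.max (hgm.min measurable_const)
  have h := hc u' M hm' (hBV.1.congr hae) (by rw [← hypVariation_congr_ae hae]; exact hBV.2) hpos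
    (fun x => le_max_left _ _) (fun x => max_le hpos.le (min_le_right _ _))
  rw [← hypVariation_congr_ae hae, ← hypEnergy_congr_ae hae, hMtop] at h
  refine le_trans (le_of_eq (lintegral_congr_ae ?_)) h
  filter_upwards [hae] with x hx
  rw [hx]

end

theorem mainTheorem7 (n : ℕ) [NeZero n] (hn : 2 ≤ n) (α : ℝ) (hα : 0 < α) (hαn : α < n) :
    (∃ c₇ : ℝ≥0, ∀ u : EuclideanSpace ℝ (Fin n) → ℝ,
      HypBV u → MemLp u ∞ (hypVol n) → (∀ᵐ x ∂(hypVol n), 0 ≤ u x) →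
        ∫⁻ x, ENNReal.ofReal (u x ^ 2) ∂(hypVol n) ≤
          c₇ * eLpNorm u ∞ (hypVol n) ^ ((n - α) / (n + 1 - α)) *
            hypVariation u ^ ((n - α) / (n + 1 - α)) *
            hypEnergy α u ^ (1 / (n + 1 - α))) ∧
    (∃ c₈ : ℝ≥0, ∀ (F : Set (EuclideanSpace ℝ (Fin n))) (m : ℝ≥0),
      F ⊆ hypSpace n → NullMeasurableSet F (hypVol n) → HypFinitePerimeter F →
        hypVol n F = m →
          (m : ℝ≥0∞) ≤
            c₈ * hypPerimeter F ^ ((n - α) / (n + 1 - α)) * hypNL α F ^ (1 / (n + 1 - α))) := by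

  obtain ⟨c, hc⟩ := exists_lintegral_sq_le n hn hα hαn
  refine ⟨⟨c, hc⟩, c, fun F m _ hF hP hm => ?_⟩
  have hbd : ∀ᵐ x ∂(hypVol n), ‖F.indicator (fun _ => (1 : ℝ)) x‖ ≤ 1 :=
    Eventually.of_forall fun x => by by_cases hx : x ∈ F <;> simp [hx]
  have h := hc _ hP (memLp_top_of_bound hP.1.aestronglyMeasurable 1 hbd)
    (Eventually.of_forall fun x => Set.indicator_nonneg (fun _ _ => zero_le_one) x)
  have e : ∫⁻ x, ENNReal.ofReal (F.indicator (fun _ => (1 : ℝ)) x ^ 2) ∂(hypVol n) = m := by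
    rw [← hm, ← lintegral_indicator_one₀ hF]
    congr 1
    funext x
    by_cases hx : x ∈ F <;> simp [hx]
  rw [e, hypVariation_indicator_one hF] at h
  have hθ : 0 ≤ ((n : ℝ) - α) / (n + 1 - α) := div_nonneg (by linarith) (by linarith)
  have h1 : eLpNorm (F.indicator fun _ => (1 : ℝ)) ∞ (hypVol n) ^
      (((n : ℝ) - α) / (n + 1 - α)) ≤ 1 := by
    refine ENNReal.rpow_le_one ?_ hθ
    rw [eLpNorm_exponent_top]
    simpa using eLpNormEssSup_le_of_ae_bound hbd
  refine h.trans ?_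
  unfold hypNL
  gcongr
  exact mul_le_of_le_one_right zero_le h1
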